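/- Let $\mathcal A\subset\mathbb R^d$ be a finite set whose convex hull $\Delta$ has dimension $d$. A *patch* is a family $\beta=\{\beta_{\mathbf a}\mid \mathbf a\in\mathcal A\}$ of non-negative continuous (for instance $C^\infty$) functions on $\Delta$ with no common zero in $\Delta$; its *normalized* blending functions are $\bar\beta_{\mathbf a}=\beta_{\mathbf a}/\sum_{\mathbf b}\beta_{\mathbf b}$, and its *tautological map* is $\tau(x)=\sum_{\mathbf a}\bar\beta_{\mathbf a}(x)\,\mathbf a$. The patch is *proper* if $\tau$ is a homeomorphism of $\Delta$ onto $\Delta$. A *reparametrization* of $\beta$ is a patch $\{\beta_{\mathbf a}\circ\psi\}$ with $\psi$ a homeomorphism of $\Delta$. A patch has *linear precision* if $\Lambda(x)=\sum_{\mathbf a}\bar\beta_{\mathbf a}(x)\Lambda(\mathbf a)$ on $\Delta$ for every affine function $\Lambda$ on $\mathbb R^d$. A function on $\Delta$ is called *rational* if it equals a quotient $N/D$ of real polynomials, $D\not\equiv 0$, wherever $D\neq 0$ on $\Delta$. A patch has *rational linear precision* if it is proper and its (unique) reparametrization having linear precision has rational normalized blending functions. A patch is *rational* if it has a reparametrization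 whose normalized blending functions are rational; clearing a common denominator gives real polynomials $P_{\mathbf a}$ and a map $x\mapsto[P_{\mathbf a}(x)\mid\mathbf a\in\mathcal A]$ from $\mathbb C^d$, minus the common zeros of the $P_{\mathbf a}$, to $\mathbb{CP}^{\mathcal A}$, the complex projective space with coordinates indexed by $\mathcal A$. Let $Y_\beta\subset\mathbb{CP}^{\mathcal A}$ be the Zariski closure of its image. **Theorem.** Let $\beta$ be a proper rational patch, and let $Y_\beta$ be formed from any of its rational reparametrizations as above. Then $\beta$ has rational linear precision if and only if the complexified tautological projection $$\pi_{\mathcal A}\colon Y_\beta\dashrightarrow\mathbb{CP}^d,\qquad [y_{\mathbf a}\mid \mathbf a\in\mathcal A]\longmapsto\Bigl[\sum_{\mathbf a\in\mathcal A}y_{\mathbf a}\,(1,\mathbf a)\Bigr]$$ is a birational isomorphism, that is, a rational map for which there is a rational map $\rho\colon\mathbb{CP}^d\dashrightarrow Y_\beta$ such that $\pi_{\mathcal A}\circ\rho$ and $\rho\circ\pi_{\mathcal A}$ are each defined somewhere and are the identity wherever they are defined. -/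

import Mathlib

open scoped LinearAlgebra.Projectivization

noncomputable section

namespace LinPrec

/-! ### Patches -/

/-- The domain polytope `Δ`, the convex hull of the finite set `A ⊂ ℝ^d`. -/
abbrev Polytope {d : ℕ} (A : Finset (Fin d → ℝ)) : Set (Fin d → ℝ) :=
  convexHull ℝ (A : Set (Fin d → ℝ))

/-- A parametric patch: continuous non-negative blending functions `β_a : Δ → ℝ`, `a ∈ A`,
without common zero, on the full-dimensional polytope `Δ = conv A`.  Continuity is what is
preserved by reparametrization; smooth blending functions are a special case. -/
structure Patch {d : ℕ} (A : Finset (Fin d → ℝ)) where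
  fullDim : (interior (Polytope A)).Nonempty
  blend : A → Polytope A → ℝ
  continuous_blend : ∀ a, Continuous (blend a)
  blend_nonneg : ∀ a x, 0 ≤ blend a x
  exists_blend_ne_zero : ∀ x, ∃ a, blend a x ≠ 0

namespace Patch

variable {d : ℕ} {A : Finset (Fin d → ℝ)}

/-- The normalized blending functions `β_a / ∑_b β_b`. -/
def normalized (β : Patch A) (a : A) (x : Polytope A) : ℝ :=
  β.blend a x / ∑ b, β.blend b x

/-- The patch replicates affine functions. -/
def HasLinearPrecision (β : Patch A) : Prop :=
  ∀ (Λ : (Fin d → ℝ) →ᵃ[ℝ] ℝ) (x : Polytope A),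
    Λ (x : Fin d → ℝ) = ∑ a, β.normalized a x * Λ (a : Fin d → ℝ)

/-- The tautological map `τ(x) = ∑ β_a(x) a` (with normalized blending functions). -/
def tautological (β : Patch A) (x : Polytope A) : Fin d → ℝ :=
  ∑ a, β.normalized a x • (a : Fin d → ℝ)

/-- The tautological map is a homeomorphism of `Δ` onto itself. -/
def IsProper (β : Patch A) : Prop :=
  ∃ h : Polytope A ≃ₜ Polytope A, ∀ x, (h x : Fin d → ℝ) = β.tautological x

/-- Reparametrization by a homeomorphism of `Δ`. -/
def reparam (β : Patch A) (ψ : Polytope A ≃ₜ Polytope A) : Patch A where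
  fullDim := β.fullDim
  blend a x := β.blend a (ψ x)
  continuous_blend a := (β.continuous_blend a).comp ψ.continuous
  blend_nonneg a x := β.blend_nonneg a (ψ x)
  exists_blend_ne_zero x := β.exists_blend_ne_zero (ψ x)

end Patch

/-- `f : Δ → ℝ` is a rational function: a quotient `N / D` of polynomials, `D` not the zero
polynomial, at all points of `Δ` where `D` does not vanish. (Such points are dense in a
full-dimensional `Δ`.) -/
def IsRationalFunction {d : ℕ} {A : Finset (Fin d → ℝ)} (f : Polytope A → ℝ) : Prop :=
  ∃ N D : MvPolynomial (Fin d) ℝ, D ≠ 0 ∧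
    ∀ x : Polytope A, MvPolynomial.eval (x : Fin d → ℝ) D ≠ 0 →
      f x = MvPolynomial.eval (x : Fin d → ℝ) N / MvPolynomial.eval (x : Fin d → ℝ) D

/-- The patch is proper, and its reparametrization having linear precision has rational
(normalized) blending functions. -/
def Patch.HasRationalLinearPrecision {d : ℕ} {A : Finset (Fin d → ℝ)} (β : Patch A) : Prop :=
  β.IsProper ∧ ∃ ψ : Polytope A ≃ₜ Polytope A,
    (β.reparam ψ).HasLinearPrecision ∧ ∀ a, IsRationalFunction ((β.reparam ψ).normalized a)

/-- A rational parametrization of a patch: a reparametrization whose normalized blending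
functions are the rational functions `num a / den`, written over a common denominator.
Clearing this denominator gives the polynomials `num a`.  A patch is rational when it has a
rational parametrization. -/
structure RationalParametrization {d : ℕ} {A : Finset (Fin d → ℝ)} (β : Patch A) where
  homeo : Polytope A ≃ₜ Polytope A
  num : A → MvPolynomial (Fin d) ℝ
  den : MvPolynomial (Fin d) ℝ
  den_ne_zero : den ≠ 0
  normalized_eq : ∀ (a : A) (x : Polytope A),
    MvPolynomial.eval (x : Fin d → ℝ) den ≠ 0 →
      (β.reparam homeo).normalized a x =
        MvPolynomial.eval (x : Fin d → ℝ) (num a) / MvPolynomial.eval (x : Fin d → ℝ) den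

/-! ### Complex projective varieties and rational maps -/

/-- Complex projective space with homogeneous coordinates indexed by `ι`. -/
abbrev CP (ι : Type) : Type := ℙ ℂ (ι → ℂ)

/-- Zariski closure in projective space: the common zeros of all homogeneous polynomials
vanishing on `S`. -/
def zariskiClosure {ι : Type} (S : Set (CP ι)) : Set (CP ι) :=
  {y | ∀ (n : ℕ) (F : MvPolynomial ι ℂ), F.IsHomogeneous n →
    (∀ s ∈ S, MvPolynomial.eval s.rep F = 0) → MvPolynomial.eval y.rep F = 0}

/-- Evaluation of a family of polynomials at a vector. -/
def evalFamily {ι κ : Type} (F : κ → MvPolynomial ι ℂ) (v : ι → ℂ) : κ → ℂ :=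
  fun j => MvPolynomial.eval v (F j)

/-- The family `F` gives a rational map `Y ⇢ Z`, for an irreducible projective variety `Y`:
its members are homogeneous of the same degree, do not all vanish identically on `Y`, and
`[F(y)]` lies in `Z` for each `y ∈ Y` outside the common zeros of the family. -/
structure IsRationalMap {ι κ : Type} (F : κ → MvPolynomial ι ℂ)
    (Y : Set (CP ι)) (Z : Set (CP κ)) : Prop where
  homogeneous : ∃ n, ∀ j, (F j).IsHomogeneous n
  defined : ∃ y ∈ Y, evalFamily F y.rep ≠ 0
  mapsTo : ∀ y ∈ Y, ∀ h : evalFamily F y.rep ≠ 0, Projectivization.mk ℂ (evalFamily F y.rep) h ∈ Z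

/-- The composition `G ∘ F` is defined at some point of `Y`, and is the identity at each point
of `Y` where it is defined. -/
def CompIsId {ι κ : Type} (F : κ → MvPolynomial ι ℂ) (G : ι → MvPolynomial κ ℂ)
    (Y : Set (CP ι)) : Prop :=
  (∃ y ∈ Y, evalFamily F y.rep ≠ 0 ∧ evalFamily G (evalFamily F y.rep) ≠ 0) ∧
  ∀ y ∈ Y, evalFamily F y.rep ≠ 0 → ∀ h : evalFamily G (evalFamily F y.rep) ≠ 0,
    Projectivization.mk ℂ (evalFamily G (evalFamily F y.rep)) h = y

/-- The family `F` gives a birational isomorphism `Y ⇢ Z`. -/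
def IsBirational {ι κ : Type} (F : κ → MvPolynomial ι ℂ)
    (Y : Set (CP ι)) (Z : Set (CP κ)) : Prop :=
  IsRationalMap F Y Z ∧
    ∃ G : ι → MvPolynomial κ ℂ, IsRationalMap G Z Y ∧ CompIsId F G Y ∧ CompIsId G F Z

/-! ### The variety of a rational patch and the tautological projection -/

/-- The image of the complexified map `[num a | a ∈ A] : ℂ^d ∖ B → ℂP^A`, where `B` is the set of
common zeros of the polynomials `num a`. -/
def RationalParametrization.image {d : ℕ} {A : Finset (Fin d → ℝ)} {β : Patch A}
    (p : RationalParametrization β) : Set (CP A) :=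
  {y | ∃ (x : Fin d → ℂ) (h : (fun a : A => MvPolynomial.aeval x (p.num a)) ≠ 0),
    y = Projectivization.mk ℂ (fun a : A => MvPolynomial.aeval x (p.num a)) h}

/-- The variety `Y_β`, the Zariski closure of the image of the complexified blending map. -/
def RationalParametrization.variety {d : ℕ} {A : Finset (Fin d → ℝ)} {β : Patch A}
    (p : RationalParametrization β) : Set (CP A) :=
  zariskiClosure p.image

/-- The tautological projection `π_A : ℂP^A ⇢ ℂP^d`, `[y] ↦ [∑ y_a (1, a)]`, as a family of
linear forms. -/
def tautProj {d : ℕ} (A : Finset (Fin d → ℝ)) (i : Fin (d + 1)) : MvPolynomial A ℂ :=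
  ∑ a : A, MvPolynomial.C (((Fin.cons 1 (a : Fin d → ℝ) : Fin (d + 1) → ℝ) i : ℝ) : ℂ) *
    MvPolynomial.X a

end LinPrec

end

/-! Let `τ` be the tautological homeomorphism and let `w a` be the normalized blending function
composed with `τ⁻¹`. The `w a` are the blending functions of the reparametrization with linear
precision: they sum to `1` and `∑ w a z • a = z`. A rational parametrization is then, up to the
scalar `den`, `x ↦ [w a (θ x)]` for a homeomorphism `θ` of `Δ`, and the projection sends this point
to `[1, θ x]`. So at real points the inverse of the projection is `z ↦ [w a z]`, and the question is
whether this map is given by polynomials.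

If the `w a` are rational, clearing denominators and homogenizing gives a candidate inverse `G`
(`IsBarycentricForm.isBirational`). Conversely, a rational inverse `G` is proportional to `w` at
generic real points, so `w a` is `G a / ∑ G b` there (`IsBarycentricForm.isRationalFunction`); since
`G` may have complex coefficients, real and imaginary parts are compared.

The passage between real points and complex varieties rests on density: a complex polynomial
vanishing on a nonempty relatively open part of `Δ` is zero (`eq_zero_of_vanishes_on_open`). -/

noncomputable section

namespace LinPrec

open MvPolynomial

/-! ### Evaluation of polynomials at real points -/

/-- The complex point with the given real coordinates. -/
def complexify {σ : Type*} (x : σ → ℝ) : σ → ℂ := fun i => (x i : ℂ)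

theorem eval_complexify_map {σ : Type*} (x : σ → ℝ) (P : MvPolynomial σ ℝ) :
    eval (complexify x) (map (algebraMap ℝ ℂ) P) = (eval x P : ℂ) := by
  have := MvPolynomial.map_eval (algebraMap ℝ ℂ) x P
  simp only [Complex.coe_algebraMap] at this
  rw [this]
  rfl

theorem map_algebraMap_ne_zero {σ : Type*} {P : MvPolynomial σ ℝ} (hP : P ≠ 0) :
    map (algebraMap ℝ ℂ) P ≠ 0 := by
  intro h
  exact hP (map_injective _ (algebraMap ℝ ℂ).injective (by rw [h, map_zero]))

theorem continuous_complexify {σ : Type*} :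
    Continuous (complexify : (σ → ℝ) → σ → ℂ) :=
  continuous_pi fun i => Complex.continuous_ofReal.comp (continuous_apply i)

/-- A complex polynomial is the sum of its real part and `I` times its imaginary part. -/
theorem exists_re_im {σ : Type*} (P : MvPolynomial σ ℂ) :
    ∃ R J : MvPolynomial σ ℝ, P = map (algebraMap ℝ ℂ) R + C Complex.I * map (algebraMap ℝ ℂ) J := by
  induction P using MvPolynomial.induction_on with
  | C c =>
    refine ⟨C c.re, C c.im, ?_⟩
    simp only [map_C, Complex.coe_algebraMap, ← C_mul, ← C_add]
    congr 1
    rw [mul_comm]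
    exact (Complex.re_add_im c).symm
  | add p q hp hq =>
    obtain ⟨R, J, rfl⟩ := hp
    obtain ⟨R', J', rfl⟩ := hq
    exact ⟨R + R', J + J', by simp only [map_add]; ring⟩
  | mul_X p i hp =>
    obtain ⟨R, J, rfl⟩ := hp
    exact ⟨R * X i, J * X i, by simp only [map_mul, map_X]; ring⟩

/-- A complex polynomial vanishing on a nonempty open set of real points is zero. -/
theorem eq_zero_of_eval_complexify_eq_zero {d : ℕ} {U : Set (Fin d → ℝ)} (hU : IsOpen U)
    (hne : U.Nonempty) {Q : MvPolynomial (Fin d) ℂ}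
    (hQ : ∀ x ∈ U, eval (complexify x) Q = 0) : Q = 0 := by
  obtain ⟨x, hx⟩ := hne
  obtain ⟨ε, hε, hball⟩ := Metric.isOpen_iff.1 hU x hx
  -- A ball for the sup norm is a product of intervals, and a polynomial vanishing on a product of
  -- infinite sets is zero.
  refine MvPolynomial.funext_set
    (fun i => (fun t : ℝ => (t : ℂ)) '' Metric.ball (x i) ε) (fun i => ?_) fun y hy => ?_
  · refine Set.Infinite.image Complex.ofReal_injective.injOn ?_
    rw [Real.ball_eq_Ioo]
    exact Set.Ioo_infinite (by linarith)
  · choose t ht hty using fun i => hy i (Set.mem_univ i)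
    have : y = complexify t := funext fun i => (hty i).symm
    rw [this, map_zero]
    refine hQ t (hball ?_)
    rw [ball_pi _ hε]
    exact fun i _ => ht i

/-! ### Zariski density of the polytope -/

section Polytope

variable {d : ℕ} {A : Finset (Fin d → ℝ)}

/-- A complex polynomial vanishing on a nonempty relatively open subset of a full-dimensional
polytope is zero. -/
theorem eq_zero_of_vanishes_on_open (hA : (interior (Polytope A)).Nonempty)
    {U : Set (Polytope A)} (hU : IsOpen U) (hne : U.Nonempty) {Q : MvPolynomial (Fin d) ℂ}
    (hQ : ∀ x ∈ U, eval (complexify (x : Fin d → ℝ)) Q = 0) : Q = 0 := by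
  obtain ⟨V, hV, rfl⟩ := isOpen_induced_iff.1 hU
  obtain ⟨x, hx⟩ := hne
  -- The given point may lie on the boundary of the polytope; by convexity it is still a limit of
  -- interior points.
  have hcl : (x : Fin d → ℝ) ∈ closure (interior (Polytope A)) := by
    rw [(convex_convexHull ℝ _).closure_interior_eq_closure_of_nonempty_interior hA]
    exact subset_closure x.2
  have hne' : (V ∩ interior (Polytope A)).Nonempty :=
    mem_closure_iff.1 hcl V hV hx
  exact eq_zero_of_eval_complexify_eq_zero (hV.inter isOpen_interior) hne'
    fun y hy => hQ ⟨y, interior_subset hy.2⟩ hy.1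

theorem isOpen_eval_ne_zero (Q : MvPolynomial (Fin d) ℂ) :
    IsOpen {x : Polytope A | eval (complexify (x : Fin d → ℝ)) Q ≠ 0} :=
  isOpen_ne_fun ((MvPolynomial.continuous_eval Q).comp
    (continuous_complexify.comp continuous_subtype_val)) continuous_const

theorem dense_eval_ne_zero (hA : (interior (Polytope A)).Nonempty) {Q : MvPolynomial (Fin d) ℂ}
    (hQ : Q ≠ 0) : Dense {x : Polytope A | eval (complexify (x : Fin d → ℝ)) Q ≠ 0} := by
  rw [dense_iff_inter_open]
  intro U hU hne
  by_contra h
  refine hQ (eq_zero_of_vanishes_on_open hA hU hne fun x hx => ?_)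
  by_contra hx'
  exact h ⟨x, hx, hx'⟩

end Polytope

/-! ### Homogeneous polynomials -/

theorem eval_bind₁ {ι κ R : Type*} [CommSemiring R] (F : κ → MvPolynomial ι R)
    (G : MvPolynomial κ R) (v : ι → R) :
    eval v (bind₁ F G) = eval (fun j => eval v (F j)) G := by
  simp only [eval, eval₂Hom_bind₁]

theorem eval_smul_of_isHomogeneous {ι R : Type*} [CommSemiring R] {F : MvPolynomial ι R} {n : ℕ}
    (hF : F.IsHomogeneous n) (c : R) (v : ι → R) : eval (c • v) F = c ^ n * eval v F := by
  rw [eval_eq, eval_eq, Finset.mul_sum]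
  refine Finset.sum_congr rfl fun m hm => ?_
  have hdeg : ∑ i ∈ m.support, m i = n := (hF.degree_eq_sum_deg_support hm).symm
  simp only [Pi.smul_apply, smul_eq_mul, mul_pow, Finset.prod_mul_distrib]
  rw [Finset.prod_pow_eq_pow_sum, hdeg]
  ring

/-- A polynomial of degree at most `n` has a homogenization of degree `n`. -/
theorem exists_homogenization {d : ℕ} {R : Type*} [CommSemiring R] (P : MvPolynomial (Fin d) R)
    {n : ℕ} (hn : P.totalDegree ≤ n) :
    ∃ Q : MvPolynomial (Fin (d + 1)) R, Q.IsHomogeneous n ∧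
      ∀ z : Fin d → R, eval (Fin.cons 1 z : Fin (d + 1) → R) Q = eval z P := by
  refine ⟨∑ i ∈ Finset.range (P.totalDegree + 1),
    X 0 ^ (n - i) * rename Fin.succ (homogeneousComponent i P), ?_, fun z => ?_⟩
  · refine IsHomogeneous.sum _ _ _ fun i hi => ?_
    have hi' : i ≤ n := (Nat.lt_succ_iff.1 (Finset.mem_range.1 hi)).trans hn
    have := (isHomogeneous_X_pow (R := R) (0 : Fin (d + 1)) (n - i)).mul
      ((homogeneousComponent_isHomogeneous i P).rename_isHomogeneous (f := Fin.succ))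
    rwa [Nat.sub_add_cancel hi'] at this
  · conv_rhs => rw [← sum_homogeneousComponent P]
    rw [map_sum, map_sum]
    refine Finset.sum_congr rfl fun i _ => ?_
    rw [map_mul, map_pow, eval_X, Fin.cons_zero, one_pow, one_mul, eval_rename]
    rfl

/-- A homogeneous polynomial vanishing on the hyperplane `z₀ = 1` is zero. -/
theorem eq_zero_of_eval_cons_one_eq_zero {d : ℕ} {K : Type*} [Field K] [Infinite K]
    {H : MvPolynomial (Fin (d + 1)) K}
    {n : ℕ} (hH : H.IsHomogeneous n)
    (h : ∀ z : Fin d → K, eval (Fin.cons 1 z : Fin (d + 1) → K) H = 0) : H = 0 := by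
  -- Points with `v 0 = 0` cannot be rescaled to the hyperplane; the factor `X 0` takes care of them
  -- and cancels in a domain.
  have key : X 0 * H = 0 := by
    refine MvPolynomial.funext fun v => ?_
    rw [map_mul, eval_X, map_zero]
    by_cases hv : v 0 = 0
    · rw [hv, zero_mul]
    · have : v = v 0 • (Fin.cons 1 (fun i => v i.succ / v 0) : Fin (d + 1) → K) := by
        funext i
        refine Fin.cases ?_ (fun i => ?_) i
        · simp
        · simp [mul_div_cancel₀ _ hv]
      rw [this, eval_smul_of_isHomogeneous hH, h, mul_zero, mul_zero]
  exact (mul_eq_zero.1 key).resolve_left (X_ne_zero 0)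

/-- Substitution of `1` for the first variable. -/
def dehomogenize {d : ℕ} (H : MvPolynomial (Fin (d + 1)) ℂ) : MvPolynomial (Fin d) ℂ :=
  bind₁ (Fin.cons 1 X : Fin (d + 1) → MvPolynomial (Fin d) ℂ) H

theorem eval_dehomogenize {d : ℕ} (H : MvPolynomial (Fin (d + 1)) ℂ) (z : Fin d → ℂ) :
    eval z (dehomogenize H) = eval (Fin.cons 1 z : Fin (d + 1) → ℂ) H := by
  rw [dehomogenize, eval_bind₁]
  congr 2
  funext i
  refine Fin.cases ?_ (fun i => ?_) i <;> simp

/-- A homogeneous polynomial vanishing at the points `(1, z)`, with `z` in a nonempty relatively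
open subset of a full-dimensional polytope, is zero. -/
theorem eq_zero_of_homogeneous_vanishes_on_open {d : ℕ} {A : Finset (Fin d → ℝ)}
    (hA : (interior (Polytope A)).Nonempty)
    {U : Set (Polytope A)} (hU : IsOpen U) (hne : U.Nonempty) {H : MvPolynomial (Fin (d + 1)) ℂ}
    {n : ℕ} (hH : H.IsHomogeneous n)
    (h : ∀ z ∈ U, eval (Fin.cons 1 (complexify (z : Fin d → ℝ)) : Fin (d + 1) → ℂ) H = 0) :
    H = 0 := by
  have hz : dehomogenize H = 0 :=
    eq_zero_of_vanishes_on_open hA hU hne fun z hz => by rw [eval_dehomogenize]; exact h z hz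
  exact eq_zero_of_eval_cons_one_eq_zero hH fun z => by rw [← eval_dehomogenize, hz, map_zero]

/-! ### Points of projective space -/

/-- The chosen representative is a unit multiple of `v`, which scales the value by a nonzero power.
Conditions phrased with `rep` can thus be tested on any convenient vector. -/
theorem eval_mk_rep_eq_zero_iff {ι : Type} {F : MvPolynomial ι ℂ} {n : ℕ}
    (hF : F.IsHomogeneous n) {v : ι → ℂ} (hv : v ≠ 0) :
    eval (Projectivization.mk ℂ v hv).rep F = 0 ↔ eval v F = 0 := by
  obtain ⟨c, hc⟩ := Projectivization.exists_smul_eq_mk_rep ℂ v hv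
  rw [← hc, Units.smul_def, eval_smul_of_isHomogeneous hF]
  simp

/-- Vanishing 2×2 minors mean proportionality. This turns equality of projective points into
polynomial identities, to which density arguments apply. -/
theorem mk_eq_of_cross_eq {ι : Type} {u : ι → ℂ} (hu : u ≠ 0) (y : CP ι)
    (h : ∀ a b, u a * y.rep b = u b * y.rep a) : Projectivization.mk ℂ u hu = y := by
  rw [← y.mk_rep, Projectivization.mk_eq_mk_iff']
  obtain ⟨a, ha⟩ := Function.ne_iff.1 y.rep_nonzero
  rw [Pi.zero_apply] at ha
  refine ⟨u a / y.rep a, funext fun b => ?_⟩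
  rw [Pi.smul_apply, smul_eq_mul, div_mul_eq_mul_div, h a b, mul_div_cancel_right₀ _ ha]

theorem eval_bind₁_evalFamily {ι κ : Type} (F : κ → MvPolynomial ι ℂ) (G : MvPolynomial κ ℂ)
    (v : ι → ℂ) : eval v (bind₁ F G) = eval (evalFamily F v) G := by
  rw [eval_bind₁]
  rfl

theorem evalFamily_smul {ι κ : Type} {F : κ → MvPolynomial ι ℂ} {n : ℕ}
    (hF : ∀ j, (F j).IsHomogeneous n) (c : ℂ) (v : ι → ℂ) :
    evalFamily F (c • v) = c ^ n • evalFamily F v :=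
  funext fun j => eval_smul_of_isHomogeneous (hF j) c v

theorem isHomogeneous_bind₁ {ι κ : Type} {F : κ → MvPolynomial ι ℂ} {G : MvPolynomial κ ℂ}
    {m n : ℕ} (hF : ∀ j, (F j).IsHomogeneous n) (hG : G.IsHomogeneous m) :
    (bind₁ F G).IsHomogeneous (n * m) :=
  hG.aeval F hF

theorem isHomogeneous_tautProj {d : ℕ} (A : Finset (Fin d → ℝ)) (i : Fin (d + 1)) :
    (tautProj A i).IsHomogeneous 1 :=
  IsHomogeneous.sum _ _ _ fun a _ => isHomogeneous_C_mul_X _ a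

/-- The tautological projection maps real barycentric-type coordinates of `z` to `(1, z)`. -/
theorem evalFamily_tautProj_ofReal {d : ℕ} {A : Finset (Fin d → ℝ)} {w : A → ℝ} {z : Fin d → ℝ}
    (hw : ∑ a, w a = 1) (hz : ∑ a, w a • (a : Fin d → ℝ) = z) :
    evalFamily (tautProj A) (complexify w) = Fin.cons 1 (complexify z) := by
  funext i
  have h : evalFamily (tautProj A) (complexify w) i =
      ((∑ a : A, (Fin.cons 1 (a : Fin d → ℝ) : Fin (d + 1) → ℝ) i * w a : ℝ) : ℂ) := by
    simp [evalFamily, tautProj, complexify]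
  rw [h]
  refine Fin.cases ?_ (fun i => ?_) i
  · simpa using congrArg (fun t : ℝ => (t : ℂ)) hw
  · simp [complexify, ← hz, mul_comm]

/-! ### Rational functions on the polytope -/

/-- Finitely many rational functions have a common denominator. -/
theorem exists_common_denominator {d : ℕ} {A : Finset (Fin d → ℝ)} {ι : Type*} [Fintype ι]
    {f : ι → Polytope A → ℝ} (hf : ∀ a, IsRationalFunction (f a)) :
    ∃ (N : ι → MvPolynomial (Fin d) ℝ) (E : MvPolynomial (Fin d) ℝ), E ≠ 0 ∧
      ∀ a (x : Polytope A), eval (x : Fin d → ℝ) E ≠ 0 →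
        eval (x : Fin d → ℝ) (N a) = eval (x : Fin d → ℝ) E * f a x := by
  classical
  choose N D hD h using hf
  refine ⟨fun a => N a * ∏ b ∈ Finset.univ.erase a, D b, ∏ b, D b,
    Finset.prod_ne_zero_iff.2 fun b _ => hD b, fun a x hx => ?_⟩
  have hx' : eval (x : Fin d → ℝ) (D a) ≠ 0 := by
    rw [map_prod] at hx
    exact Finset.prod_ne_zero_iff.1 hx a (Finset.mem_univ a)
  rw [h a x hx', ← Finset.mul_prod_erase _ _ (Finset.mem_univ a), map_mul, map_mul]
  field_simp

variable {d : ℕ} {A : Finset (Fin d → ℝ)}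

/-! ### Barycentric form and the inverse of the tautological projection -/

namespace RationalParametrization

variable {β : Patch A}

/-- The homogeneous coordinates of the complexified blending map at `x`. -/
def coord (p : RationalParametrization β) (x : Fin d → ℂ) : A → ℂ :=
  fun a => aeval x (p.num a)

/-- The complexified numerators. -/
def complexNum (p : RationalParametrization β) (a : A) : MvPolynomial (Fin d) ℂ :=
  map (algebraMap ℝ ℂ) (p.num a)

theorem evalFamily_complexNum (p : RationalParametrization β) (x : Fin d → ℂ) :
    evalFamily p.complexNum x = p.coord x :=
  funext fun _ => eval_map _ _ _

theorem mk_mem_image (p : RationalParametrization β) {x : Fin d → ℂ} (h : p.coord x ≠ 0) :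
    Projectivization.mk ℂ (p.coord x) h ∈ p.image :=
  ⟨x, h, rfl⟩

theorem subset_variety (p : RationalParametrization β) : p.image ⊆ p.variety :=
  fun y hy _ _ _ hs => hs y hy

/-- A homogeneous form whose pullback by the blending map is zero vanishes on the variety. -/
theorem eval_rep_eq_zero_of_mem_variety (p : RationalParametrization β) {n : ℕ}
    {F : MvPolynomial A ℂ} (hF : F.IsHomogeneous n) (h : bind₁ p.complexNum F = 0)
    {y : CP A} (hy : y ∈ p.variety) : eval y.rep F = 0 := by
  refine hy n F hF ?_
  rintro s ⟨x, hx, rfl⟩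
  rw [eval_mk_rep_eq_zero_iff hF]
  change eval (p.coord x) F = 0
  rw [← p.evalFamily_complexNum, ← eval_bind₁_evalFamily, h, map_zero]

/-- Continuous functions `w a` on the polytope, in terms of which the parametrization is
`x ↦ [w a (θ x)]` for a homeomorphism `θ`, and which are barycentric coordinates. -/
structure IsBarycentricForm (p : RationalParametrization β) (w : A → Polytope A → ℝ)
    (θ : Polytope A ≃ₜ Polytope A) : Prop where
  continuous : ∀ a, Continuous (w a)
  sum_eq_one : ∀ z, ∑ a, w a z = 1
  sum_smul_eq : ∀ z : Polytope A, ∑ a, w a z • (a : Fin d → ℝ) = z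
  num_eq : ∀ a (x : Polytope A), eval (x : Fin d → ℝ) p.den ≠ 0 →
    eval (x : Fin d → ℝ) (p.num a) = eval (x : Fin d → ℝ) p.den * w a (θ x)

namespace IsBarycentricForm

variable {p : RationalParametrization β} {w : A → Polytope A → ℝ}
  {θ : Polytope A ≃ₜ Polytope A}

theorem complexify_ne_zero (hw : p.IsBarycentricForm w θ) (z : Polytope A) :
    complexify (fun a => w a z) ≠ 0 := by
  intro h
  have h0 : ∀ a, w a z = 0 := fun a => Complex.ofReal_eq_zero.1 (congrFun h a)
  simpa [h0] using hw.sum_eq_one z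

theorem coord_eq (hw : p.IsBarycentricForm w θ) {x : Polytope A}
    (hx : eval (x : Fin d → ℝ) p.den ≠ 0) :
    p.coord (complexify (x : Fin d → ℝ)) =
      (eval (x : Fin d → ℝ) p.den : ℂ) • complexify (fun a => w a (θ x)) := by
  funext a
  rw [← p.evalFamily_complexNum]
  change eval _ (map _ _) = _
  rw [eval_complexify_map, hw.num_eq a x hx, Complex.ofReal_mul]
  rfl

theorem tautProj_complexify (hw : p.IsBarycentricForm w θ) (z : Polytope A) :
    evalFamily (tautProj A) (complexify fun a => w a z) =
      Fin.cons 1 (complexify (z : Fin d → ℝ)) :=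
  evalFamily_tautProj_ofReal (hw.sum_eq_one z) (hw.sum_smul_eq z)

theorem tautProj_coord (hw : p.IsBarycentricForm w θ) {x : Polytope A}
    (hx : eval (x : Fin d → ℝ) p.den ≠ 0) :
    evalFamily (tautProj A) (p.coord (complexify (x : Fin d → ℝ))) =
      (eval (x : Fin d → ℝ) p.den : ℂ) •
        (Fin.cons 1 (complexify (θ x : Fin d → ℝ)) : Fin (d + 1) → ℂ) := by
  rw [hw.coord_eq hx, evalFamily_smul (isHomogeneous_tautProj A), pow_one, hw.tautProj_complexify]

theorem coord_ne_zero (hw : p.IsBarycentricForm w θ) {x : Polytope A}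
    (hx : eval (x : Fin d → ℝ) p.den ≠ 0) : p.coord (complexify (x : Fin d → ℝ)) ≠ 0 := by
  rw [hw.coord_eq hx]
  exact smul_ne_zero (Complex.ofReal_ne_zero.2 hx) (hw.complexify_ne_zero _)

theorem cons_one_ne_zero (z : Fin d → ℂ) : (Fin.cons 1 z : Fin (d + 1) → ℂ) ≠ 0 := fun h =>
  one_ne_zero (congrFun h 0)

/-- Rational barycentric coordinates provide an inverse of the tautological projection. -/
theorem isBirational (hw : p.IsBarycentricForm w θ) (hrat : ∀ a, IsRationalFunction (w a)) :
    IsBirational (tautProj A) p.variety Set.univ := by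
  have hA := β.fullDim
  obtain ⟨N, E, hE, hNE⟩ := exists_common_denominator hrat
  -- All numerators are homogenized to the same degree, the largest of theirs; `E` itself is
  -- dropped, being a common projective factor.
  choose G hGhom hGev using fun a => exists_homogenization (map (algebraMap ℝ ℂ) (N a))
    (Finset.le_sup (f := fun a => (map (algebraMap ℝ ℂ) (N a)).totalDegree) (Finset.mem_univ a))
  set n := Finset.univ.sup fun a => (map (algebraMap ℝ ℂ) (N a)).totalDegree
  have hG : ∀ z : Polytope A, eval (z : Fin d → ℝ) E ≠ 0 →
      evalFamily G (Fin.cons 1 (complexify (z : Fin d → ℝ))) =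
        (eval (z : Fin d → ℝ) E : ℂ) • complexify fun a => w a z := by
    intro z hz
    funext a
    change eval _ (G a) = _
    rw [hGev, eval_complexify_map, hNE a z hz, Complex.ofReal_mul]
    rfl
  -- the set of good parameters
  set V : Set (Polytope A) :=
    {x | eval (complexify (x : Fin d → ℝ)) (map (algebraMap ℝ ℂ) p.den) ≠ 0} ∩
      θ ⁻¹' {z | eval (complexify (z : Fin d → ℝ)) (map (algebraMap ℝ ℂ) E) ≠ 0} with hV
  have hVo : IsOpen V :=
    (isOpen_eval_ne_zero _).inter ((isOpen_eval_ne_zero _).preimage θ.continuous)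
  have hVd : V.Nonempty := by
    have : Nonempty (Polytope A) := ⟨⟨_, interior_subset hA.some_mem⟩⟩
    exact ((dense_eval_ne_zero hA (map_algebraMap_ne_zero p.den_ne_zero)).inter_of_isOpen_left
      ((dense_eval_ne_zero hA (map_algebraMap_ne_zero hE)).preimage θ.isOpenMap)
      (isOpen_eval_ne_zero _)).nonempty
  have hVD : ∀ x ∈ V, eval (x : Fin d → ℝ) p.den ≠ 0 := by
    intro x hx
    have := hx.1
    rwa [Set.mem_ofPred_eq, eval_complexify_map, Complex.ofReal_ne_zero] at this
  have hVE : ∀ x ∈ V, eval (θ x : Fin d → ℝ) E ≠ 0 := by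
    intro x hx
    have := hx.2
    rwa [Set.mem_preimage, Set.mem_ofPred_eq, eval_complexify_map, Complex.ofReal_ne_zero] at this
  have hUo : IsOpen (θ '' V) := θ.isOpenMap V hVo
  have hUd : (θ '' V).Nonempty := hVd.image θ
  -- With `D` and `E` the values of the denominators at `x` and `θ x`: the projection gives `D • (1,
  -- θ x)`, then `G` gives `D ^ n * E • w (θ x)`, while the starting vector is `D • w (θ x)`.
  have hGπ : ∀ x ∈ V, ∃ c : ℂ, c ≠ 0 ∧
      evalFamily G (evalFamily (tautProj A) (p.coord (complexify (x : Fin d → ℝ)))) =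
        c • p.coord (complexify (x : Fin d → ℝ)) := by
    intro x hx
    have hD : (eval (x : Fin d → ℝ) p.den : ℂ) ≠ 0 := Complex.ofReal_ne_zero.2 (hVD x hx)
    refine ⟨(eval (x : Fin d → ℝ) p.den : ℂ) ^ n * (eval (θ x : Fin d → ℝ) E : ℂ) /
      (eval (x : Fin d → ℝ) p.den : ℂ),
      div_ne_zero (mul_ne_zero (pow_ne_zero _ hD) (Complex.ofReal_ne_zero.2 (hVE x hx))) hD, ?_⟩
    rw [hw.tautProj_coord (hVD x hx), evalFamily_smul hGhom, hG _ (hVE x hx),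
      hw.coord_eq (hVD x hx), smul_smul, smul_smul, div_mul_cancel₀ _ hD]
  -- the composite `G ∘ π` is the identity on the variety
  have hcross : ∀ y ∈ p.variety, ∀ a b,
      evalFamily G (evalFamily (tautProj A) y.rep) a * y.rep b =
        evalFamily G (evalFamily (tautProj A) y.rep) b * y.rep a := by
    intro y hy a b
    have hhom : (bind₁ (tautProj A) (G a) * X b - bind₁ (tautProj A) (G b) * X a).IsHomogeneous
        (1 * n + 1) :=
      ((isHomogeneous_bind₁ (isHomogeneous_tautProj A) (hGhom a)).mul (isHomogeneous_X _ b)).sub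
        ((isHomogeneous_bind₁ (isHomogeneous_tautProj A) (hGhom b)).mul (isHomogeneous_X _ a))
    have hev : ∀ v : A → ℂ,
        eval v (bind₁ (tautProj A) (G a) * X b - bind₁ (tautProj A) (G b) * X a) =
          evalFamily G (evalFamily (tautProj A) v) a * v b -
            evalFamily G (evalFamily (tautProj A) v) b * v a := by
      intro v
      rw [map_sub, map_mul, map_mul, eval_X, eval_X, eval_bind₁_evalFamily, eval_bind₁_evalFamily]
      rfl
    have := p.eval_rep_eq_zero_of_mem_variety hhom
      (eq_zero_of_vanishes_on_open hA hVo hVd fun x hx => by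
        obtain ⟨c, -, hc⟩ := hGπ x hx
        rw [eval_bind₁_evalFamily, p.evalFamily_complexNum, hev, hc]
        simp only [Pi.smul_apply, smul_eq_mul]
        ring) hy
    rw [hev] at this
    exact sub_eq_zero.1 this
  -- the composite `π ∘ G` is the identity
  have hcross' : ∀ v : Fin (d + 1) → ℂ, ∀ i j,
      evalFamily (tautProj A) (evalFamily G v) i * v j =
        evalFamily (tautProj A) (evalFamily G v) j * v i := by
    intro v i j
    have hhom : (bind₁ G (tautProj A i) * X j - bind₁ G (tautProj A j) * X i).IsHomogeneous
        (n * 1 + 1) :=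
      ((isHomogeneous_bind₁ hGhom (isHomogeneous_tautProj A i)).mul (isHomogeneous_X _ j)).sub
        ((isHomogeneous_bind₁ hGhom (isHomogeneous_tautProj A j)).mul (isHomogeneous_X _ i))
    have hev : ∀ v : Fin (d + 1) → ℂ,
        eval v (bind₁ G (tautProj A i) * X j - bind₁ G (tautProj A j) * X i) =
          evalFamily (tautProj A) (evalFamily G v) i * v j -
            evalFamily (tautProj A) (evalFamily G v) j * v i := by
      intro v
      rw [map_sub, map_mul, map_mul, eval_X, eval_X, eval_bind₁_evalFamily, eval_bind₁_evalFamily]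
      rfl
    have hzero := eq_zero_of_homogeneous_vanishes_on_open hA hUo hUd hhom (by
      rintro _ ⟨x, hx, rfl⟩
      rw [hev, hG _ (hVE x hx), evalFamily_smul (isHomogeneous_tautProj A), hw.tautProj_complexify]
      simp only [Pi.smul_apply, smul_eq_mul]
      ring)
    have := hev v
    rw [hzero, map_zero] at this
    exact sub_eq_zero.1 this.symm
  -- If `F` vanishes on the image, then `F ∘ G` vanishes at `(1, z)` for `z ∈ θ '' V`, hence
  -- identically.
  have hmapsTo : ∀ y ∈ (Set.univ : Set (CP (Fin (d + 1)))), ∀ h : evalFamily G y.rep ≠ 0,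
      Projectivization.mk ℂ (evalFamily G y.rep) h ∈ p.variety := by
    intro y _ h m F hF hvan
    rw [eval_mk_rep_eq_zero_iff hF, ← eval_bind₁_evalFamily]
    rw [eq_zero_of_homogeneous_vanishes_on_open hA hUo hUd (isHomogeneous_bind₁ hGhom hF) ?_,
      map_zero]
    rintro _ ⟨x, hx, rfl⟩
    have hvx := hvan _ (p.mk_mem_image (hw.coord_ne_zero (hVD x hx)))
    rw [eval_mk_rep_eq_zero_iff hF, hw.coord_eq (hVD x hx), eval_smul_of_isHomogeneous hF,
      mul_eq_zero] at hvx
    rw [eval_bind₁_evalFamily, hG _ (hVE x hx), eval_smul_of_isHomogeneous hF,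
      hvx.resolve_left (pow_ne_zero _ (Complex.ofReal_ne_zero.2 (hVD x hx))), mul_zero]
  -- A single good parameter witnesses that both maps and both composites are defined somewhere.
  obtain ⟨x, hx⟩ := hVd
  have hcx := hw.coord_ne_zero (hVD x hx)
  have hDx : (eval (x : Fin d → ℝ) p.den : ℂ) ≠ 0 := Complex.ofReal_ne_zero.2 (hVD x hx)
  have hEx : (eval (θ x : Fin d → ℝ) E : ℂ) ≠ 0 := Complex.ofReal_ne_zero.2 (hVE x hx)
  have hymem := p.subset_variety (p.mk_mem_image hcx)
  obtain ⟨c, hc⟩ := Projectivization.exists_smul_eq_mk_rep ℂ _ hcx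
  rw [Units.smul_def] at hc
  have hπy : evalFamily (tautProj A) (Projectivization.mk ℂ _ hcx).rep ≠ 0 := by
    rw [← hc, evalFamily_smul (isHomogeneous_tautProj A), hw.tautProj_coord (hVD x hx)]
    exact smul_ne_zero (pow_ne_zero _ c.ne_zero) (smul_ne_zero hDx (cons_one_ne_zero _))
  have hGπy : evalFamily G (evalFamily (tautProj A) (Projectivization.mk ℂ _ hcx).rep) ≠ 0 := by
    obtain ⟨k, hk, hkx⟩ := hGπ x hx
    rw [← hc, evalFamily_smul (isHomogeneous_tautProj A), evalFamily_smul hGhom, hkx]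
    exact smul_ne_zero (pow_ne_zero _ (pow_ne_zero _ c.ne_zero)) (smul_ne_zero hk hcx)
  obtain ⟨k, hk⟩ := Projectivization.exists_smul_eq_mk_rep ℂ _
    (cons_one_ne_zero (complexify (θ x : Fin d → ℝ)))
  rw [Units.smul_def] at hk
  have hGz : evalFamily G (Projectivization.mk ℂ _
      (cons_one_ne_zero (complexify (θ x : Fin d → ℝ)))).rep ≠ 0 := by
    rw [← hk, evalFamily_smul hGhom, hG _ (hVE x hx)]
    exact smul_ne_zero (pow_ne_zero _ k.ne_zero) (smul_ne_zero hEx (hw.complexify_ne_zero _))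
  have hπGz : evalFamily (tautProj A) (evalFamily G (Projectivization.mk ℂ _
      (cons_one_ne_zero (complexify (θ x : Fin d → ℝ)))).rep) ≠ 0 := by
    rw [← hk, evalFamily_smul hGhom, hG _ (hVE x hx),
      evalFamily_smul (isHomogeneous_tautProj A), evalFamily_smul (isHomogeneous_tautProj A),
      hw.tautProj_complexify]
    exact smul_ne_zero (pow_ne_zero _ (pow_ne_zero _ k.ne_zero))
      (smul_ne_zero (pow_ne_zero _ hEx) (cons_one_ne_zero _))
  exact ⟨⟨⟨1, isHomogeneous_tautProj A⟩, ⟨_, hymem, hπy⟩, fun _ _ _ => Set.mem_univ _⟩, G,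
    ⟨⟨n, hGhom⟩, ⟨_, Set.mem_univ _, hGz⟩, hmapsTo⟩,
    ⟨⟨_, hymem, hπy, hGπy⟩, fun y hy _ h => mk_eq_of_cross_eq h y (hcross y hy)⟩,
    ⟨⟨_, Set.mem_univ _, hGz, hπGz⟩, fun y _ _ h => mk_eq_of_cross_eq h y (hcross' y.rep)⟩⟩

/-- A rational inverse of the tautological projection makes the barycentric coordinates
rational. -/
theorem isRationalFunction (hw : p.IsBarycentricForm w θ)
    (hbir : IsBirational (tautProj A) p.variety Set.univ) (a : A) :
    IsRationalFunction (w a) := by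
  have hA := β.fullDim
  obtain ⟨-, G, ⟨⟨n, hGhom⟩, -, -⟩, ⟨⟨y, hy, -, hGy⟩, hid⟩, -⟩ := hbir
  -- the inverse is defined at a generic point of the image
  obtain ⟨b, hb⟩ := Function.ne_iff.1 hGy
  have hQ : bind₁ p.complexNum (bind₁ (tautProj A) (G b)) ≠ 0 := by
    intro h
    refine hb ?_
    have := p.eval_rep_eq_zero_of_mem_variety
      (isHomogeneous_bind₁ (isHomogeneous_tautProj A) (hGhom b)) h hy
    rwa [eval_bind₁_evalFamily] at this
  -- on a dense set, `G (1, z)` is proportional to `w z`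
  set V : Set (Polytope A) :=
    {x | eval (complexify (x : Fin d → ℝ)) (map (algebraMap ℝ ℂ) p.den) ≠ 0} ∩
      {x | eval (complexify (x : Fin d → ℝ))
        (bind₁ p.complexNum (bind₁ (tautProj A) (G b))) ≠ 0}
  have hVd : Dense V :=
    (dense_eval_ne_zero hA (map_algebraMap_ne_zero p.den_ne_zero)).inter_of_isOpen_left
      (dense_eval_ne_zero hA hQ) (isOpen_eval_ne_zero _)
  have hUd : Dense (θ '' V) := θ.surjective.denseRange.dense_image θ.continuous hVd
  have hprop : ∀ z ∈ θ '' V, ∃ c : ℂ, c ≠ 0 ∧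
      evalFamily G (Fin.cons 1 (complexify (z : Fin d → ℝ))) = c • complexify fun a => w a z := by
    rintro _ ⟨x, ⟨hx, hx'⟩, rfl⟩
    rw [Set.mem_ofPred_eq, eval_complexify_map, Complex.ofReal_ne_zero] at hx
    rw [Set.mem_ofPred_eq, eval_bind₁_evalFamily, p.evalFamily_complexNum, eval_bind₁_evalFamily]
      at hx'
    have hDx : (eval (x : Fin d → ℝ) p.den : ℂ) ≠ 0 := Complex.ofReal_ne_zero.2 hx
    have hcx := hw.coord_ne_zero hx
    obtain ⟨k, hk⟩ := Projectivization.exists_smul_eq_mk_rep ℂ _ hcx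
    rw [Units.smul_def] at hk
    have hG0 : evalFamily G (evalFamily (tautProj A) (p.coord (complexify (x : Fin d → ℝ)))) ≠ 0 :=
      fun h => hx' (congrFun h b)
    have hπ : evalFamily (tautProj A) (Projectivization.mk ℂ _ hcx).rep ≠ 0 := by
      rw [← hk, evalFamily_smul (isHomogeneous_tautProj A), hw.tautProj_coord hx]
      exact smul_ne_zero (pow_ne_zero _ k.ne_zero) (smul_ne_zero hDx (cons_one_ne_zero _))
    have hGπ : evalFamily G (evalFamily (tautProj A) (Projectivization.mk ℂ _ hcx).rep) ≠ 0 := by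
      rw [← hk, evalFamily_smul (isHomogeneous_tautProj A), evalFamily_smul hGhom]
      exact smul_ne_zero (pow_ne_zero _ (pow_ne_zero _ k.ne_zero)) hG0
    have heq := hid _ (p.subset_variety (p.mk_mem_image hcx)) hπ hGπ
    obtain ⟨t, ht⟩ := (Projectivization.mk_eq_mk_iff ℂ _ _ hGπ hcx).1 heq
    rw [← hk, evalFamily_smul (isHomogeneous_tautProj A), evalFamily_smul hGhom,
      hw.tautProj_coord hx, evalFamily_smul hGhom, hw.coord_eq hx, Units.smul_def, pow_one,
      smul_smul, smul_smul] at ht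
    have hs : (k : ℂ) ^ n * (eval (x : Fin d → ℝ) p.den : ℂ) ^ n ≠ 0 :=
      mul_ne_zero (pow_ne_zero _ k.ne_zero) (pow_ne_zero _ hDx)
    -- At this point `ht` reads `(t * D) • w z = (k ^ n * D ^ n) • G (1, z)` with `z = θ x` and `D`
    -- the value of `den`.
    refine ⟨((k : ℂ) ^ n * (eval (x : Fin d → ℝ) p.den : ℂ) ^ n)⁻¹ *
      (t * (eval (x : Fin d → ℝ) p.den : ℂ)),
      mul_ne_zero (inv_ne_zero hs) (mul_ne_zero t.ne_zero hDx), ?_⟩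
    rw [mul_smul, ht, smul_smul, inv_mul_cancel₀ hs, one_smul]
  -- dehomogenize and separate real and imaginary parts
  have hsum : ∀ (z : Polytope A) (c : ℂ),
      evalFamily G (Fin.cons 1 (complexify (z : Fin d → ℝ))) = c • complexify (fun a => w a z) →
      eval (complexify (z : Fin d → ℝ)) (∑ b, dehomogenize (G b)) = c := by
    intro z c hc
    have hGb : ∀ b, eval (complexify (z : Fin d → ℝ)) (dehomogenize (G b)) = c * (w b z : ℂ) :=
      fun b => by rw [eval_dehomogenize]; exact congrFun hc b
    rw [map_sum, Finset.sum_congr rfl fun b _ => hGb b, ← Finset.mul_sum,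
      ← Complex.ofReal_sum, hw.sum_eq_one, Complex.ofReal_one, mul_one]
  -- By `hsum` the factor of proportionality is `∑ G b`, so this sum is the denominator of `w a`.
  obtain ⟨R, J, hRJ⟩ := exists_re_im (dehomogenize (G a))
  obtain ⟨R', J', hRJ'⟩ := exists_re_im (∑ b, dehomogenize (G b))
  have hparts : ∀ z : Polytope A,
      eval (z : Fin d → ℝ) R = eval (z : Fin d → ℝ) R' * w a z ∧
      eval (z : Fin d → ℝ) J = eval (z : Fin d → ℝ) J' * w a z := by
    have hcont : ∀ P : MvPolynomial (Fin d) ℝ,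
        Continuous fun z : Polytope A => eval (z : Fin d → ℝ) P := fun P =>
      (MvPolynomial.continuous_eval P).comp continuous_subtype_val
    have hclosed : IsClosed {z : Polytope A |
        eval (z : Fin d → ℝ) R = eval (z : Fin d → ℝ) R' * w a z ∧
        eval (z : Fin d → ℝ) J = eval (z : Fin d → ℝ) J' * w a z} :=
      (isClosed_eq (hcont R) ((hcont R').mul (hw.continuous a))).inter
        (isClosed_eq (hcont J) ((hcont J').mul (hw.continuous a)))
    intro z
    -- Both identities are closed conditions by continuity of `w a`, so it suffices to check them on
    -- the dense set `θ '' V`.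
    refine (hclosed.closure_subset_iff.2 ?_) (hUd z)
    intro z hz
    obtain ⟨c, -, hc⟩ := hprop z hz
    have hkey : eval (complexify (z : Fin d → ℝ)) (dehomogenize (G a)) =
        eval (complexify (z : Fin d → ℝ)) (∑ b, dehomogenize (G b)) * (w a z : ℂ) := by
      rw [hsum z c hc, eval_dehomogenize]
      exact congrFun hc a
    rw [hRJ, hRJ', map_add, map_add, map_mul, map_mul, eval_C, eval_complexify_map,
      eval_complexify_map, eval_complexify_map, eval_complexify_map] at hkey
    have hre := congrArg Complex.re hkey
    have him := congrArg Complex.im hkey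
    simp at hre him
    exact ⟨hre, him⟩
  -- Either pair gives a fraction for `w a`, provided its denominator is nonzero; `R'` and `J'`
  -- cannot both be zero, since the sum takes a value `c ≠ 0`.
  by_cases hR' : R' = 0
  · refine ⟨J, J', fun hJ' => ?_, fun z hz => ?_⟩
    · have : Nonempty (Polytope A) := ⟨⟨_, interior_subset hA.some_mem⟩⟩
      obtain ⟨z, hz⟩ := hUd.nonempty
      obtain ⟨c, hc0, hc⟩ := hprop z hz
      refine hc0 ?_
      rw [← hsum z c hc, hRJ', hR', hJ']
      simp
    · rw [(hparts z).2, mul_div_cancel_left₀ _ hz]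
  · exact ⟨R, R', hR', fun z hz => by rw [(hparts z).1, mul_div_cancel_left₀ _ hz]⟩

end IsBarycentricForm

end RationalParametrization

/-! ### Linear precision and the tautological map -/

namespace Patch

variable (β : Patch A)

theorem sum_blend_ne_zero (x : Polytope A) : ∑ b, β.blend b x ≠ 0 := by
  obtain ⟨a, ha⟩ := β.exists_blend_ne_zero x
  intro h
  exact ha ((Finset.sum_eq_zero_iff_of_nonneg fun b _ => β.blend_nonneg b x).1 h a
    (Finset.mem_univ a))

theorem sum_normalized (x : Polytope A) : ∑ a, β.normalized a x = 1 := by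
  simp only [normalized]
  rw [← Finset.sum_div, div_self (β.sum_blend_ne_zero x)]

theorem continuous_normalized (a : A) : Continuous (β.normalized a) :=
  (β.continuous_blend a).div (continuous_finsetSum _ fun b _ => β.continuous_blend b)
    β.sum_blend_ne_zero

theorem reparam_normalized (ψ : Polytope A ≃ₜ Polytope A) (a : A) (x : Polytope A) :
    (β.reparam ψ).normalized a x = β.normalized a (ψ x) :=
  rfl

/-- A patch has linear precision if and only if its tautological map is the identity. -/
theorem hasLinearPrecision_iff :
    β.HasLinearPrecision ↔ ∀ x : Polytope A, β.tautological x = x := by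
  constructor
  · intro h x
    funext i
    have := h (LinearMap.proj i : (Fin d → ℝ) →ₗ[ℝ] ℝ).toAffineMap x
    simpa [tautological] using this.symm
  · intro h Λ x
    -- An affine function is linear plus constant; the constant is reproduced because the weights
    -- sum to `1`.
    have h1 := β.sum_normalized x
    have hlin : ∀ v, Λ v = Λ.linear v + Λ 0 := fun v => by
      simpa using Λ.map_vadd 0 v
    have hx : Λ.linear (x : Fin d → ℝ) = ∑ a, β.normalized a x * Λ.linear (a : Fin d → ℝ) := by
      conv_lhs => rw [← h x]
      simp [tautological]
    have ha : ∀ a : A, β.normalized a x * Λ (a : Fin d → ℝ) =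
        β.normalized a x * Λ.linear (a : Fin d → ℝ) + β.normalized a x * Λ 0 := fun a => by
      rw [hlin (a : Fin d → ℝ), mul_add]
    rw [hlin, hx, Finset.sum_congr rfl fun a _ => ha a, Finset.sum_add_distrib, ← Finset.sum_mul, h1, one_mul]

end Patch

end LinPrec

end

theorem theorem2p2 {d : ℕ} {A : Finset (Fin d → ℝ)} (β : LinPrec.Patch A)
    (hproper : β.IsProper) (p : LinPrec.RationalParametrization β) :
    β.HasRationalLinearPrecision ↔
      LinPrec.IsBirational (LinPrec.tautProj A) p.variety (Set.univ : Set (LinPrec.CP (Fin (d + 1)))) := by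
  obtain ⟨h, hh⟩ := hproper
  have hw : p.IsBarycentricForm (fun a z => β.normalized a (h.symm z)) (p.homeo.trans h) := by
    refine ⟨fun a => (β.continuous_normalized a).comp h.symm.continuous,
      fun z => β.sum_normalized _, fun z => ?_, fun a x hx => ?_⟩
    · have := hh (h.symm z)
      rw [h.apply_symm_apply] at this
      exact this.symm
    · have := p.normalized_eq a x hx
      rw [β.reparam_normalized] at this
      simp only [Homeomorph.trans_apply, h.symm_apply_apply]
      rw [this, mul_div_cancel₀ _ hx]
  constructor
  · rintro ⟨-, ψ, hlin, hrat⟩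
    refine hw.isBirational fun a => ?_
    -- Linear precision makes the tautological map after `ψ` the identity, which forces `ψ =
    -- h.symm`.
    have hψ : ∀ x, h.symm x = ψ x := fun x => by
      rw [h.symm_apply_eq]
      refine Subtype.ext ?_
      rw [hh]
      exact (((β.reparam ψ).hasLinearPrecision_iff.1 hlin) x).symm
    simp only [hψ]
    exact hrat a
  · intro hbir
    refine ⟨⟨h, hh⟩, h.symm, (β.reparam h.symm).hasLinearPrecision_iff.2 hw.sum_smul_eq,
      hw.isRationalFunction hbir⟩
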